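/- Let $A$ be a nonempty finite alphabet and let $G$ be a group. A Følner net of $G$ is a family $\mathcal F=(F_i)_{i\in I}$ of nonempty finite subsets of $G$ over a nonempty directed set $I$ such that $\lim_{i\in I}|F_i\setminus F_ig|/|F_i|=0$ for every $g\in G$; $G$ is amenable if it has a Følner net. Equip $A^G$ with the prodiscrete topology and call $x,y\in A^G$ asymptotic if they agree outside a finite subset of $G$. For $X\subset A^G$ nonempty, put $$\overline{\mathrm{ent}}_{\mathcal F}(X)=\limsup_{i\in I}\frac{\log|X_{F_i}|}{|F_i|},\qquad X_{F_i}=\{x|_{F_i}: x\in X\}.$$ Given $M\subset G$ and $s\colon G\to A^{A^M}$, the non-uniform cellular automaton (NUCA) $\sigma_s\colon A^G\to A^G$ with memory $M$ and configuration of local transition maps $s$ is defined by $\sigma_s(x)(g)=s(g)((g^{-1}x)|_M)$, where $(gx)(h)=x(g^{-1}h)$; $s$ is asymptotically constant if there is $c\in A^{A^M}$ with $s(g)=c$ for all $g$ outside a finite subset of $G$. For $U\subset A^G$, $\tau|_U$ is pre-injective if $\tau(x)=\tau(y)$ implies $x=y$ for all asymptotic $x,y\in U$. Let $G$ be amenable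 and let $\tau\colon A^G\to A^G$ be an NUCA with finite memory and asymptotically constant configuration of local transition maps. Then $\tau|_U$ is pre-injective for some nonempty open $U\subset A^G$ if and only if $\operatorname{im}\tau$ contains a nonempty open subset of $A^G$. If moreover $G$ is infinite, then the following are equivalent: (a) $\tau|_U$ is pre-injective for some nonempty open subset $U\subset A^G$; (b) $\overline{\mathrm{ent}}_{\mathcal F}(\operatorname{im}\tau)=\log|A|$ for some Følner net $\mathcal F$ of $G$; (b') $\overline{\mathrm{ent}}_{\mathcal F}(\operatorname{im}\tau)=\log|A|$ for every Følner net $\mathcal F$ of $G$; (c) $\operatorname{im}\tau$ contains a nonempty open subset of $A^G$. -/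

import Mathlib

open Filter Topology

universe u v w

namespace NUCA

/-- The Bernoulli shift of `G` on `A^G`: `(g x)(h) = x(g⁻¹ h)`. -/
def shift {G : Type u} {A : Type v} [Group G] (g : G) (x : G → A) : G → A :=
  fun h => x (g⁻¹ * h)

/-- Two configurations are asymptotic if they agree outside some finite subset of `G`. -/
def Asymptotic {G : Type u} {B : Type v} (x y : G → B) : Prop :=
  ∃ E : Set G, E.Finite ∧ ∀ g, g ∉ E → x g = y g

/-- A configuration in `B^G` is asymptotically constant if it is
asymptotic to a constant configuration. -/
def AsymptoticallyConstant {G : Type u} {B : Type v} (s : G → B) : Prop :=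
  ∃ c : B, Asymptotic s (fun _ => c)

/-- The non-uniform cellular automaton `σ_s` with memory `M` and configuration of local
transition maps `s ∈ (A^(A^M))^G`: `σ_s(x)(g) = s(g)((g⁻¹ x)|_M)`. -/
def nuca {G : Type u} {A : Type v} [Group G] (M : Set G) (s : G → (M → A) → A) :
    (G → A) → (G → A) :=
  fun x g => s g (M.domRestrict (shift g⁻¹ x))

/-- The class of non-uniform cellular automata over `G` and `A` that have a finite memory and
an asymptotically constant configuration of local transition maps. -/
def nucaC (G : Type u) (A : Type v) [Group G] : Set ((G → A) → (G → A)) :=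
  {τ | ∃ M : Set G, M.Finite ∧ ∃ s : G → (M → A) → A, AsymptoticallyConstant s ∧ τ = nuca M s}

/-- The restriction of `τ` to `U` is pre-injective. -/
def PreInjectiveOn {G : Type u} {A : Type v} (τ : (G → A) → (G → A)) (U : Set (G → A)) : Prop :=
  ∀ x ∈ U, ∀ y ∈ U, Asymptotic x y → τ x = τ y → x = y

/-- A Følner net (of nonempty finite subsets) of `G`:
`lim |F_i \ F_i g| / |F_i| = 0` for all `g`. -/
def IsFolnerNet {G : Type u} [Group G] {I : Type w} [Preorder I] (F : I → Finset G) : Prop :=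
  (∀ i, (F i).Nonempty) ∧
    ∀ g : G, Tendsto
      (fun i => (((F i : Set G) \ ((fun h => h * g) '' (F i : Set G))).ncard : ℝ) / (F i).card)
      atTop (𝓝 0)

/-- A group is amenable if it admits a Følner net. (Directed index sets in the universe of `G`
are enough, since one can always use `Finset G × ℕ`.) -/
def Amenable (G : Type u) [Group G] : Prop :=
  ∃ (I : Type u) (_ : Preorder I) (_ : IsDirectedOrder I) (_ : Nonempty I) (F : I → Finset G),
    IsFolnerNet F

/-- The upper natural mean entropy `limsup log |X_{F_i}| / |F_i|` of a nonempty subset `X` of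
`A^G`, where `A` is finite and `X_{F_i}` is the set of restrictions to `F_i` of elements of `X`.
The family takes values in `[0, log |A|]`, so this is the true upper limit. -/
noncomputable def upperEntropy {G : Type u} {A : Type v} {I : Type w} [Preorder I]
    (F : I → Finset G) (X : Set (G → A)) : ℝ :=
  limsup (fun i => Real.log (((F i : Set G).domRestrict '' X).ncard : ℝ) / (F i).card) atTop

end NUCA

/-!
Let `τ = nuca M s` with `s = c` off a finite set `E`, and let `X` be its image.

*Full entropy from (a) or (c).* If `X` contains a cylinder over `K`, then `X` has at least
`|A|^(|F| - |K|)` restrictions to `F`. If `τ` is pre-injective on a cylinder over `K`, the same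
lower bound holds up to a factor `|A|^|∂F|`, where `∂F` is a boundary of `F`: configurations that
differ only deep inside `F` and off `K` have images that agree off `F`. In an infinite group `|F|`
tends to infinity along every Følner net, so both bounds force the entropy `log |A|`
(`upperEntropy_eq_log`).

*Consequences of full entropy.* The image of the uniform automaton `nuca M (fun _ => c)` differs
from `X` only over `E`, so it has full entropy along the same net as `X`. As in the classical
Garden of Eden theorem, the uniform automaton is then surjective and pre-injective. Otherwise there
is a finite pattern, over `K` say, which the image (resp. some set of configurations having the same
image) avoids along any packing of `F` by translates of `K`. A maximal packing has at least about
`|F| / |K|²` members (`exists_isPacking`), and each of them costs a factor `1 - |A|^(-|K|)`, so the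
entropy would be smaller than `log |A|` (`upperEntropy_lt_log`).

*Back to `τ`.* Pre-injectivity passes from the uniform automaton to `τ` on a cylinder over `E M`,
since there the values of the image over `E` are fixed (`exists_preInjectiveOn`). Surjectivity of
the uniform automaton says that every configuration lies in `X` after a change of its values on
`E`; there are finitely many possible values and `X` is closed, so Baire's theorem gives an open
subset of `X` (`exists_isOpen_subset_range`).
-/

namespace NUCA

/-! ### Counting restrictions -/

lemma ncard_image_le_mul {Z P Q R : Type*} [Finite Q] [Finite R] (S : Set Z)
    (φ : Z → P) (ψ : Z → Q) (χ : Z → R)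
    (h : ∀ z ∈ S, ∀ z' ∈ S, ψ z = ψ z' → χ z = χ z' → φ z = φ z') :
    (φ '' S).ncard ≤ (ψ '' S).ncard * Nat.card R := by
  rcases S.eq_empty_or_nonempty with rfl | ⟨z₀, -⟩
  · simp
  have : Nonempty Z := ⟨z₀⟩
  have key : ∀ p : P, p ∈ φ '' S → ∃ z ∈ S, φ z = p := fun p hp => hp
  choose! r hrS hr using key
  rw [← Set.ncard_univ R, ← Set.ncard_prod]
  refine Set.ncard_le_ncard_of_injOn (fun p => (ψ (r p), χ (r p))) ?_ ?_ (Set.toFinite _)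
  · intro p hp
    exact ⟨⟨r p, hrS p hp, rfl⟩, Set.mem_univ _⟩
  · intro p hp q hq hpq
    rw [← hr p hp, ← hr q hq]
    exact h _ (hrS p hp) _ (hrS q hq) (congrArg Prod.fst hpq) (congrArg Prod.snd hpq)

lemma card_finset_fun {G A : Type*} (K : Finset G) :
    Nat.card (K → A) = Nat.card A ^ K.card := by
  rw [Nat.card_fun, Nat.card_eq_fintype_card (α := K), Fintype.card_coe]

lemma ncard_restrict_pos {G A : Type*} [Finite A] {X : Set (G → A)} (hX : X.Nonempty) (F : Finset G) :
    0 < ((F : Set G).domRestrict '' X).ncard :=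
  (Set.ncard_pos (Set.toFinite _)).2 (hX.image _)

lemma ncard_restrict_le {G A : Type*} [Finite A] (X : Set (G → A)) (F : Finset G) :
    ((F : Set G).domRestrict '' X).ncard ≤ Nat.card A ^ F.card :=
  (Set.ncard_le_card _).trans_eq (card_finset_fun F)

/-! ### Locality of cellular automata -/

variable {G : Type u} [Group G] {A : Type v}

lemma nuca_congr {M : Set G} {s s' : G → (M → A) → A} {x y : G → A} {g h : G}
    (hs : s g = s' h) (hxy : ∀ m ∈ M, x (g * m) = y (h * m)) :
    nuca M s x g = nuca M s' y h := by
  have : M.domRestrict (shift g⁻¹ x) = M.domRestrict (shift h⁻¹ y) := by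
    funext m
    simpa [shift] using hxy m m.2
  simp only [nuca, hs, this]

lemma nuca_const_shift {M : Set G} (c : (M → A) → A) (t : G) (x : G → A) (g : G) :
    nuca M (fun _ => c) (fun h => x (t * h)) g = nuca M (fun _ => c) x (t * g) :=
  nuca_congr rfl fun m _ => by rw [mul_assoc]

lemma continuous_nuca [TopologicalSpace A] [DiscreteTopology A] {M : Set G} (hM : M.Finite)
    (s : G → (M → A) → A) : Continuous (nuca M s) := by
  have := hM.to_subtype
  refine continuous_pi fun g => ?_
  refine (continuous_of_discreteTopology (f := s g)).comp ?_
  exact continuous_pi fun m => continuous_apply _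

/-! ### Boundaries and Følner nets -/

open Classical in
/-- The elements `g` of `F` for which the translate `g C` is not contained in `F`. -/
noncomputable def boundary (F C : Finset G) : Finset G :=
  F.filter fun g => ∃ m ∈ C, g * m ∉ F

lemma mem_boundary {F C : Finset G} {g : G} :
    g ∈ boundary F C ↔ g ∈ F ∧ ∃ m ∈ C, g * m ∉ F := by
  simp [boundary]

lemma boundary_subset (F C : Finset G) : boundary F C ⊆ F := fun _ hg => (mem_boundary.1 hg).1

lemma mul_mem_of_notMem_boundary {F C : Finset G} {g m : G} (hg : g ∈ F)
    (hgb : g ∉ boundary F C) (hm : m ∈ C) : g * m ∈ F := by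
  by_contra h
  exact hgb (mem_boundary.2 ⟨hg, m, hm, h⟩)

lemma card_boundary_le (F C : Finset G) :
    (boundary F C).card ≤
      ∑ m ∈ C, ((F : Set G) \ ((fun h => h * m⁻¹) '' (F : Set G))).ncard := by
  classical
  have hsub : boundary F C ⊆ C.biUnion fun m => F \ F.image fun h => h * m⁻¹ := by
    intro g hg
    obtain ⟨hgF, m, hm, hgm⟩ := mem_boundary.1 hg
    refine Finset.mem_biUnion.2 ⟨m, hm, Finset.mem_sdiff.2 ⟨hgF, fun h => hgm ?_⟩⟩
    obtain ⟨k, hk, rfl⟩ := Finset.mem_image.1 h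
    simpa using hk
  refine (Finset.card_le_card hsub).trans (Finset.card_biUnion_le.trans (Finset.sum_le_sum ?_))
  intro m _
  rw [← Set.ncard_coe_finset]
  simp

section Folner

variable {I : Type*} [Preorder I] {F : I → Finset G}

lemma IsFolnerNet.tendsto_boundary (hF : IsFolnerNet F) (C : Finset G) :
    Tendsto (fun i => ((boundary (F i) C).card : ℝ) / (F i).card) atTop (𝓝 0) := by
  have h := tendsto_finsetSum C fun m _ => hF.2 m⁻¹
  rw [Finset.sum_const_zero] at h
  refine squeeze_zero (fun i => by positivity) (fun i => ?_) h
  rw [← Finset.sum_div]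
  gcongr
  exact_mod_cast card_boundary_le (F i) C

/-- If few elements of `F i` lie in the boundary for a set `S`, then `F i` contains a translate
of `S`; in an infinite group `S` can be taken arbitrarily large. -/
lemma IsFolnerNet.tendsto_card [Infinite G] (hF : IsFolnerNet F) :
    Tendsto (fun i => (F i).card) atTop atTop := by
  classical
  refine tendsto_atTop.2 fun n => ?_
  obtain ⟨S, hS⟩ := Infinite.exists_subset_card_eq G n
  filter_upwards [(hF.tendsto_boundary S).eventually (gt_mem_nhds one_pos)] with i hi
  have hpos : (0 : ℝ) < (F i).card := by exact_mod_cast (hF.1 i).card_pos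
  rw [div_lt_one hpos, Nat.cast_lt] at hi
  obtain ⟨g, hg, hgb⟩ := Finset.exists_mem_notMem_of_card_lt_card hi
  rw [← hS, ← Finset.card_image_of_injective S (mul_right_injective g)]
  refine Finset.card_le_card fun k hk => ?_
  obtain ⟨m, hm, rfl⟩ := Finset.mem_image.1 hk
  exact mul_mem_of_notMem_boundary hg hgb hm

lemma IsFolnerNet.tendsto_const_div_card [Infinite G] (hF : IsFolnerNet F) (r : ℝ) :
    Tendsto (fun i => r / ((F i).card : ℝ)) atTop (𝓝 0) :=
  (tendsto_natCast_atTop_atTop.comp hF.tendsto_card).const_div_atTop r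

end Folner

/-! ### Packings by translates -/

/-- `T` indexes pairwise disjoint left translates `t K` (`t ∈ T`) all contained in `F`. -/
structure IsPacking (F K T : Finset G) : Prop where
  mul_mem : ∀ t ∈ T, ∀ k ∈ K, t * k ∈ F
  eq_of_mul_eq : ∀ t ∈ T, ∀ t' ∈ T, ∀ k ∈ K, ∀ k' ∈ K, t * k = t' * k' → t = t'

/-- For a maximal packing `T`, the sets `t K K⁻¹` cover every `g ∈ F` with `g K ⊆ F`. -/
lemma exists_isPacking (F K : Finset G) (hK : K.Nonempty) :
    ∃ T, IsPacking F K T ∧ F.card ≤ (boundary F K).card + T.card * K.card ^ 2 := by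
  classical
  let S := (F \ boundary F K).powerset.filter (IsPacking F K)
  have hS : S.Nonempty := ⟨∅, Finset.mem_filter.2 ⟨by simp, by simp, by simp⟩⟩
  obtain ⟨T, hTS, hT⟩ := Finset.exists_max_image S Finset.card hS
  obtain ⟨hTF, hTp⟩ := Finset.mem_filter.1 hTS
  refine ⟨T, hTp, ?_⟩
  have hcov : F \ boundary F K ⊆ (T ×ˢ (K ×ˢ K)).image fun p => p.1 * p.2.1 * p.2.2⁻¹ := by
    intro g hg
    obtain ⟨hgF, hgb⟩ := Finset.mem_sdiff.1 hg
    by_contra hn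
    have hmeet : ∀ t ∈ T, ∀ k ∈ K, ∀ k' ∈ K, g * k' ≠ t * k := by
      intro t ht k hk k' hk' h
      refine hn (Finset.mem_image.2 ⟨(t, k, k'), by simp [ht, hk, hk'], ?_⟩)
      simp [← h]
    obtain ⟨k₀, hk₀⟩ := hK
    have hgT : g ∉ T := fun h => hmeet g h k₀ hk₀ k₀ hk₀ rfl
    have hins : insert g T ∈ S := by
      refine Finset.mem_filter.2 ⟨?_, ?_, ?_⟩
      · rw [Finset.mem_powerset] at hTF ⊢
        exact Finset.insert_subset hg hTF
      · intro t ht k hk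
        rcases Finset.mem_insert.1 ht with rfl | ht
        · exact mul_mem_of_notMem_boundary hgF hgb hk
        · exact hTp.mul_mem t ht k hk
      · intro t ht t' ht' k hk k' hk' h
        rcases Finset.mem_insert.1 ht with htg | ht <;>
          rcases Finset.mem_insert.1 ht' with htg' | ht'
        · rw [htg, htg']
        · exact absurd (htg ▸ h) (hmeet t' ht' k' hk' k hk)
        · exact absurd (htg' ▸ h.symm) (hmeet t ht k hk k' hk')
        · exact hTp.eq_of_mul_eq t ht t' ht' k hk k' hk' h
    have := hT _ hins
    rw [Finset.card_insert_of_notMem hgT] at this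
    omega
  have h1 := (Finset.card_le_card hcov).trans Finset.card_image_le
  rw [Finset.card_product, Finset.card_product, ← sq] at h1
  have h2 := Finset.card_sdiff_add_card_eq_card (boundary_subset F K)
  omega

/-- `Y` avoids the pattern `p|_K` at every place `t ∈ T`. -/
def Avoids (Y : Set (G → A)) (p : G → A) (K T : Finset G) : Prop :=
  ∀ z ∈ Y, ∀ t ∈ T, ∃ k ∈ K, z (t * k) ≠ p k

/-- Each translate in a packing on which a pattern is forbidden costs the factor
`1 - |A|^(-|K|)` in the number of restrictions to `F`. -/
lemma Avoids.ncard_mul_le [Finite A] {Y : Set (G → A)} {p : G → A} {F K T : Finset G}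
    (hY : Avoids Y p K T) (hT : IsPacking F K T) :
    ((F : Set G).domRestrict '' Y).ncard * (Nat.card A ^ K.card) ^ T.card ≤
      Nat.card A ^ F.card * (Nat.card A ^ K.card - 1) ^ T.card := by
  classical
  have := Fintype.ofFinite A
  let TK : Finset G := (T ×ˢ K).image fun q => q.1 * q.2
  have hTKF : TK ⊆ F := by
    intro g hg
    obtain ⟨q, hq, rfl⟩ := Finset.mem_image.1 hg
    rw [Finset.mem_product] at hq
    exact hT.mul_mem _ hq.1 _ hq.2
  have hTKcard : TK.card = T.card * K.card := by
    rw [← Finset.card_product]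
    refine Finset.card_image_of_injOn ?_
    rintro ⟨t, k⟩ hq ⟨t', k'⟩ hq' h
    simp only [Finset.coe_product, Set.mem_prod, Finset.mem_coe] at hq hq' h
    have : t = t' := hT.eq_of_mul_eq t hq.1 t' hq'.1 k hq.2 k' hq'.2 h
    subst this
    simpa using h
  let P := {q : K → A // q ≠ fun k : K => p k}
  have hPcard : Nat.card P = Nat.card A ^ K.card - 1 := by
    rw [Nat.card_eq_fintype_card, Fintype.card_subtype_compl]
    simp
  let f : Y → ((F \ TK : Finset G) → A) × (T → P) := fun z =>
    (fun g => z.1 g, fun t => ⟨fun k => z.1 (t * k), fun h => by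
      obtain ⟨k, hk, hne⟩ := hY z.1 z.2 t t.2
      exact hne (congrFun h ⟨k, hk⟩)⟩)
  have hle : ((F : Set G).domRestrict '' Y).ncard ≤
      Nat.card (((F \ TK : Finset G) → A) × (T → P)) := by
    have h := ncard_image_le_mul (Set.univ : Set Y)
      (fun z => (F : Set G).domRestrict z.1) (fun _ => ()) f ?_
    · have e : (fun z : Y => (F : Set G).domRestrict z.1) '' Set.univ =
          (F : Set G).domRestrict '' Y := by
        ext; simp
      rw [e] at h
      refine h.trans ?_
      have : ((fun _ : Y => ()) '' Set.univ).ncard ≤ 1 := Set.ncard_le_one_of_subsingleton _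
      calc _ ≤ 1 * _ := Nat.mul_le_mul_right _ this
        _ = _ := one_mul _
    · rintro ⟨z, hz⟩ - ⟨z', hz'⟩ - - h
      funext ⟨g, hg⟩
      change z g = z' g
      by_cases hgT : g ∈ TK
      · obtain ⟨⟨t, k⟩, hq, rfl⟩ := Finset.mem_image.1 hgT
        rw [Finset.mem_product] at hq
        have := congrFun (congrArg Subtype.val (congrFun (congrArg Prod.snd h) ⟨t, hq.1⟩)) ⟨k, hq.2⟩
        exact this
      · exact congrFun (congrArg Prod.fst h) ⟨g, Finset.mem_sdiff.2 ⟨hg, hgT⟩⟩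
  rw [Nat.card_prod, Nat.card_fun, Nat.card_fun, hPcard] at hle
  simp only [Nat.card_eq_fintype_card (α := ((F \ TK : Finset G))),
    Nat.card_eq_fintype_card (α := T), Fintype.card_coe] at hle
  have hF : F.card = (F \ TK).card + K.card * T.card := by
    rw [mul_comm, ← hTKcard, Finset.card_sdiff_add_card_eq_card hTKF]
  rw [hF, pow_add, pow_mul]
  calc _ ≤ _ := Nat.mul_le_mul_right _ hle
    _ = _ := by ring

/-! ### Entropy estimates -/

section Entropy

variable {I : Type*} [Preorder I] [IsDirectedOrder I] [Nonempty I] {F : I → Finset G}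

/-- If the number of restrictions to `F` falls short of `|A|^|F|` by a factor that is
subexponential along Følner nets, the entropy is maximal. -/
lemma upperEntropy_eq_log [Infinite G] [Finite A] [Nonempty A] (hF : IsFolnerNet F)
    {X : Set (G → A)} (hX : X.Nonempty) (C : Finset G) (e : ℕ)
    (h : ∀ F : Finset G, Nat.card A ^ F.card ≤
      ((F : Set G).domRestrict '' X).ncard * Nat.card A ^ ((boundary F C).card + e)) :
    upperEntropy F X = Real.log (Nat.card A) := by
  have hA : (0 : ℝ) < Nat.card A := by exact_mod_cast Nat.card_pos
  refine Tendsto.limsup_eq ?_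
  set a := Real.log (Nat.card A)
  have hlow : Tendsto (fun i => a - (((boundary (F i) C).card : ℝ) / (F i).card * a +
      (e * a) / (F i).card)) atTop (𝓝 a) := by
    simpa using tendsto_const_nhds.sub
      (((hF.tendsto_boundary C).mul_const a).add (hF.tendsto_const_div_card (e * a)))
  refine tendsto_of_tendsto_of_tendsto_of_le_of_le hlow tendsto_const_nhds (fun i => ?_)
    fun i => ?_
  · have hpos : (0 : ℝ) < (F i).card := by exact_mod_cast (hF.1 i).card_pos
    have hn : (0 : ℝ) < (((F i : Set G).domRestrict '' X).ncard : ℝ) := by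
      exact_mod_cast ncard_restrict_pos hX (F i)
    have h1 : ((Nat.card A : ℝ)) ^ (F i).card ≤
        (((F i : Set G).domRestrict '' X).ncard : ℝ) *
          (Nat.card A : ℝ) ^ ((boundary (F i) C).card + e) := by exact_mod_cast h (F i)
    have h2 := Real.log_le_log (by positivity) h1
    rw [Real.log_mul hn.ne' (by positivity), Real.log_pow, Real.log_pow] at h2
    push_cast at h2
    simp only
    rw [le_div_iff₀ hpos]
    have : (a - (((boundary (F i) C).card : ℝ) / (F i).card * a + (e * a) / (F i).card)) *
        (F i).card = (F i).card * a - ((boundary (F i) C).card + e) * a := by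
      field_simp
    rw [this]
    linarith
  · have hpos : (0 : ℝ) < (F i).card := by exact_mod_cast (hF.1 i).card_pos
    have hn : (0 : ℝ) < (((F i : Set G).domRestrict '' X).ncard : ℝ) := by
      exact_mod_cast ncard_restrict_pos hX (F i)
    have h1 : (((F i : Set G).domRestrict '' X).ncard : ℝ) ≤
        (Nat.card A : ℝ) ^ (F i).card := by exact_mod_cast ncard_restrict_le X (F i)
    have h2 := Real.log_le_log hn h1
    rw [Real.log_pow] at h2
    simp only
    rw [div_le_iff₀ hpos]
    linarith

/-- If, up to a factor that is subexponential along Følner nets, the restrictions of `X` to `F`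
are counted by configurations avoiding a fixed pattern along any packing of `F`, then the
entropy of `X` is not maximal. -/
lemma upperEntropy_lt_log [Infinite G] [Finite A] [Nontrivial A] (hF : IsFolnerNet F)
    {X : Set (G → A)} (hX : X.Nonempty) (C K : Finset G) (hK : K.Nonempty) (e : ℕ) (p : G → A)
    (h : ∀ F T : Finset G, IsPacking F K T → ∃ Y : Set (G → A), Avoids Y p K T ∧
      ((F : Set G).domRestrict '' X).ncard ≤
        ((F : Set G).domRestrict '' Y).ncard * Nat.card A ^ ((boundary F C).card + e)) :
    upperEntropy F X < Real.log (Nat.card A) := by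
  have hA2 : 1 < Nat.card A := Finite.one_lt_card
  have hA : (0 : ℝ) < Nat.card A := by exact_mod_cast Nat.card_pos
  set a := Real.log (Nat.card A) with ha
  set N : ℕ := Nat.card A ^ K.card with hN
  have hN2 : 2 ≤ N := Nat.one_lt_pow hK.card_pos.ne' hA2
  set δ : ℝ := Real.log N - Real.log (N - 1 : ℕ) with hδ
  have hN1 : (0 : ℝ) < (N - 1 : ℕ) := by exact_mod_cast (by omega : 0 < N - 1)
  have hN0 : (0 : ℝ) < N := by exact_mod_cast (by omega : 0 < N)
  have hδ0 : 0 < δ := sub_pos.2 (Real.log_lt_log hN1 (by exact_mod_cast (by omega : N - 1 < N)))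
  have hk : (0 : ℝ) < K.card := by exact_mod_cast hK.card_pos
  set η : ℝ := δ / (K.card : ℝ) ^ 2 with hη
  have hη0 : 0 < η := by positivity
  have hup : Tendsto (fun i => a - η + (((boundary (F i) C).card : ℝ) / (F i).card * a +
      (e * a) / (F i).card + ((boundary (F i) K).card : ℝ) / (F i).card * η))
      atTop (𝓝 (a - η)) := by
    simpa using tendsto_const_nhds.add
      ((((hF.tendsto_boundary C).mul_const a).add (hF.tendsto_const_div_card (e * a))).add
        ((hF.tendsto_boundary K).mul_const η))
  refine lt_of_le_of_lt ?_ (sub_lt_self a hη0)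
  rw [← hup.limsup_eq]
  refine limsup_le_limsup (Eventually.of_forall fun i => ?_) ?_ hup.isBoundedUnder_le
  · obtain ⟨T, hT, hTcard⟩ := exists_isPacking (F i) K hK
    obtain ⟨Y, hY, hXY⟩ := h (F i) T hT
    have hYc := hY.ncard_mul_le hT
    rw [← hN] at hYc
    have hpos : (0 : ℝ) < (F i).card := by exact_mod_cast (hF.1 i).card_pos
    have hnn := ncard_restrict_pos hX (F i)
    have hn : (0 : ℝ) < (((F i : Set G).domRestrict '' X).ncard : ℝ) := by exact_mod_cast hnn
    have h1 : ((F i : Set G).domRestrict '' X).ncard * N ^ T.card ≤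
        Nat.card A ^ (F i).card * (N - 1) ^ T.card *
          Nat.card A ^ ((boundary (F i) C).card + e) := by
      calc _ ≤ _ := Nat.mul_le_mul_right _ hXY
        _ = ((F i : Set G).domRestrict '' Y).ncard * N ^ T.card *
          Nat.card A ^ ((boundary (F i) C).card + e) := by ring
        _ ≤ _ := Nat.mul_le_mul_right _ hYc
    have h1' : (((F i : Set G).domRestrict '' X).ncard : ℝ) * (N : ℝ) ^ T.card ≤
        (Nat.card A : ℝ) ^ (F i).card * ((N - 1 : ℕ) : ℝ) ^ T.card *
          (Nat.card A : ℝ) ^ ((boundary (F i) C).card + e) := by exact_mod_cast h1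
    have h2 := Real.log_le_log (by positivity) h1'
    rw [Real.log_mul hn.ne' (by positivity), Real.log_mul (by positivity) (by positivity),
      Real.log_mul (by positivity) (by positivity), Real.log_pow, Real.log_pow, Real.log_pow,
      Real.log_pow, ← ha] at h2
    push_cast at h2
    have h3 : ((F i).card : ℝ) ≤ (boundary (F i) K).card + T.card * (K.card : ℝ) ^ 2 := by
      exact_mod_cast hTcard
    have h4 : ((F i).card - (boundary (F i) K).card : ℝ) * η ≤ T.card * δ := by
      have : T.card * δ = T.card * (K.card : ℝ) ^ 2 * η := by rw [hη]; field_simp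
      rw [this]
      exact mul_le_mul_of_nonneg_right (by linarith) hη0.le
    simp only
    rw [div_le_iff₀ hpos]
    have h5 : (a - η + (((boundary (F i) C).card : ℝ) / (F i).card * a +
      (e * a) / (F i).card + ((boundary (F i) K).card : ℝ) / (F i).card * η)) * (F i).card =
      (F i).card * a - ((F i).card - (boundary (F i) K).card : ℝ) * η +
        ((boundary (F i) C).card + e) * a := by
      field_simp
      ring
    rw [h5]
    have h6 : T.card * δ = T.card * Real.log N - T.card * Real.log (N - 1 : ℕ) := by
      rw [hδ]; ring
    linarith
  · exact (isBoundedUnder_of ⟨0, fun i => by positivity⟩ :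
      IsBoundedUnder (· ≥ ·) _ _).isCoboundedUnder_le

end Entropy
/-! ### Cylinders -/

/-- Every neighbourhood in the prodiscrete topology contains a cylinder. -/
lemma exists_cylinder_subset {G A : Type*} [TopologicalSpace A] {U : Set (G → A)} (hU : IsOpen U)
    {x : G → A} (hx : x ∈ U) : ∃ K : Finset G, ∀ z, (∀ k ∈ K, z k = x k) → z ∈ U := by
  obtain ⟨K, u, hu, hKU⟩ := isOpen_pi_iff.1 hU x hx
  refine ⟨K, fun z hz => hKU fun k hk => ?_⟩
  rw [hz k hk]
  exact (hu k hk).2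

lemma isOpen_cylinder {G A : Type*} [TopologicalSpace A] [DiscreteTopology A] (K : Finset G) (x : G → A) :
    IsOpen {z : G → A | ∀ k ∈ K, z k = x k} := by
  have : {z : G → A | ∀ k ∈ K, z k = x k} = (K : Set G).pi fun k => {x k} := by
    ext z; simp
  rw [this]
  exact isOpen_set_pi K.finite_toSet fun _ _ => isOpen_discrete _

/-! ### Maximal entropy from pre-injectivity or from an open subset of the image -/

section Full

variable {I : Type*} [Preorder I] [IsDirectedOrder I] [Nonempty I] {F : I → Finset G}

lemma upperEntropy_eq_log_of_isOpen_subset [Infinite G] [Finite A] [Nonempty A]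
    [TopologicalSpace A] (hF : IsFolnerNet F) {X V : Set (G → A)} (hV : IsOpen V)
    (hne : V.Nonempty) (hVX : V ⊆ X) :
    upperEntropy F X = Real.log (Nat.card A) := by
  classical
  obtain ⟨x, hx⟩ := hne
  obtain ⟨K, hK⟩ := exists_cylinder_subset hV hx
  refine upperEntropy_eq_log hF ⟨x, hVX hx⟩ ∅ K.card fun F => ?_
  have h1 : Nat.card A ^ (F \ K).card ≤ ((F : Set G).domRestrict '' X).ncard := by
    let f : ((F \ K : Finset G) → A) → G → A := fun a g => if h : g ∈ F \ K then a ⟨g, h⟩ else x g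
    have hf : ∀ a, f a ∈ X := fun a => hVX (hK _ fun k hk => by simp [f, hk])
    calc Nat.card A ^ (F \ K).card = (Set.univ : Set ((F \ K : Finset G) → A)).ncard := by
          rw [Set.ncard_univ, card_finset_fun]
      _ ≤ _ := by
          refine Set.ncard_le_ncard_of_injOn (fun a => (F : Set G).domRestrict (f a))
            (fun a _ => ⟨f a, hf a, rfl⟩) (fun a _ b _ hab => ?_) (Set.toFinite _)
          funext ⟨g, hg⟩
          have : f a g = f b g := congrFun hab ⟨g, (Finset.mem_sdiff.1 hg).1⟩
          simpa [f, Finset.mem_sdiff.1 hg] using this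
  calc Nat.card A ^ F.card ≤ Nat.card A ^ ((F \ K).card + K.card) :=
        Nat.pow_le_pow_right Nat.card_pos (by
          have := Finset.le_card_sdiff K F
          omega)
    _ = Nat.card A ^ (F \ K).card * Nat.card A ^ K.card := pow_add _ _ _
    _ ≤ ((F : Set G).domRestrict '' X).ncard * Nat.card A ^ K.card := Nat.mul_le_mul_right _ h1
    _ ≤ _ := Nat.mul_le_mul_left _ (Nat.pow_le_pow_right Nat.card_pos (by omega))

/-- Configurations of a cylinder in `U` that vary only deep inside `F` have images that agree
off `F`, so by pre-injectivity the images are distinguished by their restrictions to `F`. -/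
lemma upperEntropy_eq_log_of_preInjectiveOn [Infinite G] [Finite A] [Nonempty A]
    [TopologicalSpace A] (hF : IsFolnerNet F) {M : Set G} (hM : M.Finite)
    {s : G → (M → A) → A} {U : Set (G → A)} (hU : IsOpen U) (hne : U.Nonempty)
    (hinj : PreInjectiveOn (nuca M s) U) :
    upperEntropy F (Set.range (nuca M s)) = Real.log (Nat.card A) := by
  classical
  obtain ⟨x, hx⟩ := hne
  obtain ⟨K, hK⟩ := exists_cylinder_subset hU hx
  let C := hM.toFinset.image fun m => m⁻¹
  refine upperEntropy_eq_log hF ⟨_, x, rfl⟩ C K.card fun F => ?_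
  let P := (F \ boundary F C) \ K
  have h1 : Nat.card A ^ P.card ≤ ((F : Set G).domRestrict '' Set.range (nuca M s)).ncard := by
    let f : (P → A) → G → A := fun a g => if h : g ∈ P then a ⟨g, h⟩ else x g
    have hfx : ∀ a g, g ∉ P → f a g = x g := fun a g hg => by simp [f, hg]
    have hfU : ∀ a, f a ∈ U := fun a => hK _ fun k hk => hfx a k (by simp [P, hk])
    have hout : ∀ a g, g ∉ F → nuca M s (f a) g = nuca M s x g := by
      refine fun a g hg => nuca_congr rfl fun m hm => hfx a _ fun hP => hg ?_
      obtain ⟨hFb, -⟩ := Finset.mem_sdiff.1 hP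
      obtain ⟨hgF, hgb⟩ := Finset.mem_sdiff.1 hFb
      have := mul_mem_of_notMem_boundary hgF hgb
        (Finset.mem_image_of_mem (fun m => m⁻¹) (hM.mem_toFinset.2 hm))
      simpa using this
    calc Nat.card A ^ P.card = (Set.univ : Set (P → A)).ncard := by
          rw [Set.ncard_univ, card_finset_fun]
      _ ≤ _ := by
          refine Set.ncard_le_ncard_of_injOn (fun a => (F : Set G).domRestrict (nuca M s (f a)))
            (fun a _ => ⟨_, ⟨f a, rfl⟩, rfl⟩) (fun a _ b _ hab => ?_) (Set.toFinite _)
          have hab' : f a = f b := by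
            refine hinj _ (hfU a) _ (hfU b) ⟨P, P.finite_toSet, fun g hg => ?_⟩ ?_
            · rw [hfx a g hg, hfx b g hg]
            · funext g
              by_cases hg : g ∈ F
              · exact congrFun hab ⟨g, hg⟩
              · rw [hout a g hg, hout b g hg]
          funext ⟨g, hg⟩
          have := congrFun hab' g
          simpa [f, hg] using this
  calc Nat.card A ^ F.card ≤ Nat.card A ^ (P.card + ((boundary F C).card + K.card)) :=
        Nat.pow_le_pow_right Nat.card_pos (by
          have h2 : (F \ boundary F C).card - K.card ≤ P.card := Finset.le_card_sdiff K _
          have h3 := Finset.card_sdiff_add_card_eq_card (boundary_subset F C)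
          omega)
    _ = Nat.card A ^ P.card * Nat.card A ^ ((boundary F C).card + K.card) := pow_add _ _ _
    _ ≤ _ := Nat.mul_le_mul_right _ h1

end Full

/-! ### Consequences of maximal entropy for the uniform automaton -/

/-- The image of an automaton and that of its asymptotic constant differ only over the finite
exceptional set `E`. -/
lemma ncard_restrict_range_nuca_le [Finite A] {M : Set G} {s : G → (M → A) → A}
    {c : (M → A) → A} {E : Finset G} (hE : ∀ g, g ∉ E → s g = c) (F : Finset G) :
    ((F : Set G).domRestrict '' Set.range (nuca M s)).ncard ≤
      ((F : Set G).domRestrict '' Set.range (nuca M fun _ => c)).ncard *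
        Nat.card A ^ E.card := by
  rw [← Set.range_comp, ← Set.range_comp, ← Set.image_univ, ← Set.image_univ]
  have h := ncard_image_le_mul (Set.univ : Set (G → A))
    ((F : Set G).domRestrict ∘ nuca M s) ((F : Set G).domRestrict ∘ nuca M fun _ => c)
    (fun x (g : E) => nuca M s x g) ?_
  · rwa [card_finset_fun] at h
  · intro x _ y _ h1 h2
    funext ⟨g, hg⟩
    change nuca M s x g = nuca M s y g
    by_cases hgE : g ∈ E
    · exact congrFun h2 ⟨g, hgE⟩
    · have h3 : nuca M (fun _ => c) x g = nuca M (fun _ => c) y g := congrFun h1 ⟨g, hg⟩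
      have h4 : ∀ z, nuca M s z g = nuca M (fun _ => c) z g :=
        fun z => nuca_congr (hE g hgE) fun _ _ => rfl
      rw [h4, h4, h3]

/-- If two asymptotic configurations `x`, `y` have the same image, then occurrences of a large
pattern of `x` along a packing can be replaced by that of `y` without changing the image. -/
lemma exists_avoids_of_asymptotic {M : Set G} {c : (M → A) → A} {x y : G → A} {K₀ : Finset G} (hM : M.Finite)
    (hxy : ∀ g, g ∉ K₀ → x g = y g) (hne : x ≠ y)
    (him : nuca M (fun _ => c) x = nuca M (fun _ => c) y) :
    ∃ K : Finset G, K.Nonempty ∧ ∀ F T, IsPacking F K T → ∀ z : G → A, ∃ z' : G → A,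
      Avoids {z'} x K T ∧ nuca M (fun _ => c) z' = nuca M (fun _ => c) z := by
  classical
  obtain ⟨d, hd⟩ := Function.ne_iff.1 hne
  have hdK₀ : d ∈ K₀ := by
    by_contra h
    exact hd (hxy d h)
  let MF := hM.toFinset
  -- `K` contains every `g M` that meets `K₀`
  let K := K₀ ∪ (K₀ ×ˢ (MF ×ˢ MF)).image fun q => q.1 * q.2.1⁻¹ * q.2.2
  have hK₀K : ∀ g ∈ K₀, g ∈ K := fun g hg => Finset.mem_union_left _ hg
  have hK : ∀ g, ∀ m ∈ M, g * m ∈ K₀ → ∀ m' ∈ M, g * m' ∈ K := by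
    intro g m hm hgm m' hm'
    refine Finset.mem_union_right _ (Finset.mem_image.2 ⟨(g * m, m, m'), ?_, by simp⟩)
    simp [hgm, MF, hm, hm']
  refine ⟨K, ⟨d, hK₀K d hdK₀⟩, fun F T hT z => ?_⟩
  let occurs : G → Prop := fun t => t ∈ T ∧ ∀ k ∈ K, z (t * k) = x k
  let z' : G → A := fun h =>
    if H : ∃ t, occurs t ∧ t⁻¹ * h ∈ K then y (H.choose⁻¹ * h) else z h
  have hz'1 : ∀ t, occurs t → ∀ k ∈ K, z' (t * k) = y k := by
    intro t ht k hk
    have H : ∃ t', occurs t' ∧ t'⁻¹ * (t * k) ∈ K := ⟨t, ht, by simpa using hk⟩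
    have heq : t = H.choose :=
      hT.eq_of_mul_eq t ht.1 _ H.choose_spec.1.1 k hk _ H.choose_spec.2 (by simp)
    simp only [z', dif_pos H, ← heq]
    simp
  have hz'2 : ∀ h, (∀ t, occurs t → t⁻¹ * h ∉ K) → z' h = z h := by
    intro h hh
    exact dif_neg fun ⟨t, ht, htK⟩ => hh t ht htK
  refine ⟨z', ?_, ?_⟩
  · rintro _ rfl t ht
    by_cases hm : occurs t
    · exact ⟨d, hK₀K d hdK₀, by rw [hz'1 t hm d (hK₀K d hdK₀)]; exact hd.symm⟩
    · obtain ⟨k, hk, hzk⟩ : ∃ k ∈ K, z (t * k) ≠ x k := by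
        by_contra! h
        exact hm ⟨ht, h⟩
      refine ⟨k, hk, ?_⟩
      rw [hz'2]
      · exact hzk
      · intro t' ht' hK'
        have : t = t' := hT.eq_of_mul_eq t ht t' ht'.1 k hk _ hK' (by simp)
        exact hm (this ▸ ht')
  · funext g
    by_cases hg : ∃ t, occurs t ∧ ∃ m ∈ M, t⁻¹ * (g * m) ∈ K₀
    · obtain ⟨t, ht, m, hm, hgm⟩ := hg
      have hgK : ∀ m' ∈ M, t⁻¹ * g * m' ∈ K := hK _ m hm (by rwa [mul_assoc])
      have e : ∀ m', g * m' = t * (t⁻¹ * g * m') := fun m' => by group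
      calc nuca M (fun _ => c) z' g = nuca M (fun _ => c) y (t⁻¹ * g) :=
            nuca_congr rfl fun m' hm' => by rw [e m', hz'1 t ht _ (hgK m' hm')]
        _ = nuca M (fun _ => c) x (t⁻¹ * g) := by rw [him]
        _ = nuca M (fun _ => c) z g :=
            nuca_congr rfl fun m' hm' => by rw [e m', ht.2 _ (hgK m' hm')]
    · refine nuca_congr rfl fun m hm => ?_
      by_cases H : ∃ t, occurs t ∧ t⁻¹ * (g * m) ∈ K
      · obtain ⟨t, ht, htK⟩ := H
        have hn : t⁻¹ * (g * m) ∉ K₀ := fun h => hg ⟨t, ht, m, hm, h⟩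
        have e : g * m = t * (t⁻¹ * (g * m)) := by group
        rw [e, hz'1 t ht _ htK, ht.2 _ htK, hxy _ hn]
      · exact hz'2 _ fun t ht htK => H ⟨t, ht, htK⟩

section Deficient

variable [Infinite G] [Finite A] [Nonempty A] {I : Type*} [Preorder I] [IsDirectedOrder I]
  [Nonempty I] {F : I → Finset G} {M : Set G} {s : G → (M → A) → A} {c : (M → A) → A}
  {E : Finset G}

/-- A configuration outside the (closed) image has a finite pattern which, by equivariance, the
image avoids everywhere. -/
lemma surjective_of_upperEntropy_eq_log (hF : IsFolnerNet F) (hM : M.Finite)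
    (hE : ∀ g, g ∉ E → s g = c)
    (hent : upperEntropy F (Set.range (nuca M s)) = Real.log (Nat.card A)) :
    Function.Surjective (nuca M fun _ => c) := by
  classical
  by_contra hns
  let _ : TopologicalSpace A := ⊥
  have : DiscreteTopology A := ⟨rfl⟩
  obtain ⟨y, hy⟩ := not_forall.1 hns
  have hclosed : IsClosed (Set.range (nuca M fun _ => c)) :=
    (isCompact_range (continuous_nuca hM _)).isClosed
  obtain ⟨K₀, hK₀⟩ := exists_cylinder_subset hclosed.isOpen_compl (x := y) hy
  set K := insert 1 K₀
  have hK : ∀ z, ∃ k ∈ K, nuca M (fun _ => c) z k ≠ y k := by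
    intro z
    by_contra! h
    exact hK₀ _ (fun k hk => h k (Finset.mem_insert_of_mem hk)) ⟨z, rfl⟩
  have : Nontrivial A := by
    obtain ⟨k, -, hk⟩ := hK y
    exact ⟨_, _, hk⟩
  refine (upperEntropy_lt_log hF (X := Set.range (nuca M s)) (Set.range_nonempty _) ∅ K
    ⟨1, Finset.mem_insert_self _ _⟩ E.card y fun F T _ => ?_).ne hent
  refine ⟨Set.range (nuca M fun _ => c), ?_, (ncard_restrict_range_nuca_le hE F).trans ?_⟩
  · rintro _ ⟨z, rfl⟩ t -
    obtain ⟨k, hk, hne⟩ := hK fun h => z (t * h)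
    exact ⟨k, hk, by rwa [nuca_const_shift] at hne⟩
  · exact Nat.mul_le_mul_left _ (Nat.pow_le_pow_right Nat.card_pos (by omega))

lemma preInjective_of_upperEntropy_eq_log (hF : IsFolnerNet F) (hM : M.Finite)
    (hE : ∀ g, g ∉ E → s g = c)
    (hent : upperEntropy F (Set.range (nuca M s)) = Real.log (Nat.card A)) :
    PreInjectiveOn (nuca M fun _ => c) Set.univ := by
  classical
  rintro x - y - ⟨D, hD, hxy⟩ him
  by_contra hne
  have : Nontrivial A := by
    obtain ⟨d, hd⟩ := Function.ne_iff.1 hne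
    exact ⟨_, _, hd⟩
  obtain ⟨K, hKne, hK⟩ := exists_avoids_of_asymptotic (K₀ := hD.toFinset) hM
    (fun g hg => hxy g (by simpa using hg)) hne him
  refine (upperEntropy_lt_log hF (X := Set.range (nuca M s)) (Set.range_nonempty _) hM.toFinset K
    hKne E.card x fun F T hT => ?_).ne hent
  let Y : Set (G → A) := {z | Avoids {z} x K T}
  refine ⟨Y, fun z hz => hz z rfl, (ncard_restrict_range_nuca_le hE F).trans ?_⟩
  have himY : Set.range (nuca M fun _ => c) = (nuca M fun _ => c) '' Y := by
    refine Set.Subset.antisymm ?_ (Set.image_subset_range _ _)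
    rintro _ ⟨z, rfl⟩
    obtain ⟨z', hz', h⟩ := hK F T hT z
    exact ⟨z', hz', h⟩
  -- the image over `F` is determined by `z` over `F`, except on the boundary of `F`
  have hcount := ncard_image_le_mul Y ((F : Set G).domRestrict ∘ nuca M fun _ => c)
    (F : Set G).domRestrict
    (fun z (g : boundary F hM.toFinset) => nuca M (fun _ => c) z g)
    fun z _ z' _ h1 h2 => by
      funext ⟨g, hg⟩
      change nuca M (fun _ => c) z g = nuca M (fun _ => c) z' g
      by_cases hgb : g ∈ boundary F hM.toFinset
      · exact congrFun h2 ⟨g, hgb⟩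
      · exact nuca_congr rfl fun m hm => congrFun h1
          ⟨g * m, mul_mem_of_notMem_boundary hg hgb (hM.mem_toFinset.2 hm)⟩
  rw [card_finset_fun, Set.image_comp, ← himY] at hcount
  rw [pow_add, ← mul_assoc]
  exact Nat.mul_le_mul_right _ hcount

end Deficient

/-! ### From the uniform automaton to its finite perturbations -/

lemma exists_preInjectiveOn [Nonempty A] [TopologicalSpace A] [DiscreteTopology A] {M : Set G}
    (hM : M.Finite) {s : G → (M → A) → A} {c : (M → A) → A} {E : Finset G}
    (hE : ∀ g, g ∉ E → s g = c) (h : PreInjectiveOn (nuca M fun _ => c) Set.univ) :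
    ∃ U : Set (G → A), IsOpen U ∧ U.Nonempty ∧ PreInjectiveOn (nuca M s) U := by
  classical
  obtain ⟨a⟩ := ‹Nonempty A›
  let K := (E ×ˢ hM.toFinset).image fun q => q.1 * q.2
  refine ⟨_, isOpen_cylinder K fun _ => a, ⟨fun _ => a, fun _ _ => rfl⟩, ?_⟩
  intro x hx y hy hxy him
  refine h x trivial y trivial hxy (funext fun g => ?_)
  by_cases hg : g ∈ E
  · refine nuca_congr rfl fun m hm => ?_
    have hgm : g * m ∈ K := Finset.mem_image.2 ⟨(g, m), by simp [hg, hm], rfl⟩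
    rw [hx _ hgm, hy _ hgm]
  · have e : ∀ z, nuca M s z g = nuca M (fun _ => c) z g :=
      fun z => nuca_congr (hE g hg) fun _ _ => rfl
    rw [← e, ← e, him]

/-- Every configuration can be changed on `E` so as to lie in the closed image; by Baire's
theorem a single choice of the values on `E` works for all configurations in an open set. -/
lemma exists_isOpen_subset_range [Finite A] [Nonempty A] [TopologicalSpace A]
    [DiscreteTopology A] {M : Set G}
    (hM : M.Finite) {s : G → (M → A) → A} {c : (M → A) → A} {E : Finset G}
    (hE : ∀ g, g ∉ E → s g = c) (h : Function.Surjective (nuca M fun _ => c)) :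
    ∃ V : Set (G → A), IsOpen V ∧ V.Nonempty ∧ V ⊆ Set.range (nuca M s) := by
  classical
  have hclosed : IsClosed (Set.range (nuca M s)) :=
    (isCompact_range (continuous_nuca hM _)).isClosed
  let patch : (E → A) → (G → A) → G → A := fun p y g => if hg : g ∈ E then p ⟨g, hg⟩ else y g
  have hpatch : ∀ p, Continuous (patch p) := by
    refine fun p => continuous_pi fun g => ?_
    by_cases hg : g ∈ E
    · simpa [patch, hg] using continuous_const
    · simpa [patch, hg] using continuous_apply g
  have hcover : ⋃ p, patch p ⁻¹' Set.range (nuca M s) = Set.univ := by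
    refine Set.eq_univ_of_forall fun y => Set.mem_iUnion.2 ?_
    obtain ⟨x, rfl⟩ := h y
    refine ⟨fun g => nuca M s x g, x, funext fun g => ?_⟩
    by_cases hg : g ∈ E
    · simp [patch, hg]
    · simpa [patch, hg] using nuca_congr (hE g hg) fun _ _ => rfl
  obtain ⟨p, y, hy⟩ := nonempty_interior_of_iUnion_of_closed
    (fun p => hclosed.preimage (hpatch p)) hcover
  obtain ⟨K, hK⟩ := exists_cylinder_subset isOpen_interior hy
  refine ⟨_, isOpen_cylinder (K ∪ E) (patch p y), ⟨_, fun _ _ => rfl⟩, fun z hz => ?_⟩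
  -- `z` has the pattern `p` on `E`, and off `E` it agrees with `w`, which is `y` on `K`
  let w : G → A := fun g => if g ∈ E then y g else z g
  have hw : w ∈ patch p ⁻¹' Set.range (nuca M s) := by
    refine interior_subset (hK w fun k hk => ?_)
    by_cases hkE : k ∈ E
    · simp [w, hkE]
    · simpa [w, patch, hkE] using hz k (Finset.mem_union_left _ hk)
  have hzw : patch p w = z := by
    funext g
    by_cases hg : g ∈ E
    · simpa [patch, hg] using (hz g (Finset.mem_union_right _ hg)).symm
    · simp [patch, w, hg]
  rw [← hzw]
  exact hw

/-- A Følner net may be reindexed by a lift of its index set to a larger universe. -/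
lemma IsFolnerNet.comp_down {I : Type u} [Preorder I] {F : I → Finset G} (hF : IsFolnerNet F) :
    IsFolnerNet fun i : ULift.{w} I => F i.down := by
  refine ⟨fun i => hF.1 _, fun g => (hF.2 g).comp ?_⟩
  exact tendsto_atTop.2 fun b => eventually_ge_atTop (ULift.up b)

end NUCA

open NUCA in
theorem theoremA {G : Type u} [Group G] (hG : NUCA.Amenable G)
    {A : Type v} [Finite A] [Nonempty A] [TopologicalSpace A] [DiscreteTopology A]
    (τ : (G → A) → (G → A)) (hτ : τ ∈ NUCA.nucaC G A) :
    ((∃ U : Set (G → A), IsOpen U ∧ U.Nonempty ∧ NUCA.PreInjectiveOn τ U) ↔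
      (∃ V : Set (G → A), IsOpen V ∧ V.Nonempty ∧ V ⊆ Set.range τ)) ∧
    (Infinite G → List.TFAE
      [∃ U : Set (G → A), IsOpen U ∧ U.Nonempty ∧ NUCA.PreInjectiveOn τ U,
        ∃ (I : Type (max u w)) (_ : Preorder I) (_ : IsDirectedOrder I) (_ : Nonempty I)
          (F : I → Finset G), NUCA.IsFolnerNet F ∧
            NUCA.upperEntropy F (Set.range τ) = Real.log (Nat.card A),
        ∀ (I : Type (max u w)) (_ : Preorder I) (_ : IsDirectedOrder I) (_ : Nonempty I)
          (F : I → Finset G), NUCA.IsFolnerNet F →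
            NUCA.upperEntropy F (Set.range τ) = Real.log (Nat.card A),
        ∃ V : Set (G → A), IsOpen V ∧ V.Nonempty ∧ V ⊆ Set.range τ]) := by
  obtain ⟨M, hM, s, ⟨c, E, hEfin, hE⟩, rfl⟩ := hτ
  have hE' : ∀ g, g ∉ hEfin.toFinset → s g = c := fun g hg => hE g (by simpa using hg)
  obtain ⟨I₀, _, _, _, F₀, hF₀⟩ := hG
  constructor
  · rcases finite_or_infinite G with hfin | hinf
    · -- for finite `G` the space is finite and discrete, so points are open
      have x : G → A := Classical.arbitrary _
      refine iff_of_true ⟨{x}, isOpen_discrete _, ⟨x, rfl⟩, ?_⟩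
        ⟨{nuca M s x}, isOpen_discrete _, ⟨_, rfl⟩, ?_⟩
      · rintro _ rfl _ rfl - -
        rfl
      · rintro _ rfl
        exact ⟨x, rfl⟩
    · constructor
      · rintro ⟨U, hU, hne, hinj⟩
        exact exists_isOpen_subset_range hM hE' (surjective_of_upperEntropy_eq_log hF₀ hM hE'
          (upperEntropy_eq_log_of_preInjectiveOn hF₀ hM hU hne hinj))
      · rintro ⟨V, hV, hne, hVX⟩
        exact exists_preInjectiveOn hM hE' (preInjective_of_upperEntropy_eq_log hF₀ hM hE'
          (upperEntropy_eq_log_of_isOpen_subset hF₀ hV hne hVX))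
  · intro hinf
    tfae_have 1 → 3 := by
      rintro ⟨U, hU, hne, hinj⟩ I _ _ _ F hF
      exact upperEntropy_eq_log_of_preInjectiveOn hF hM hU hne hinj
    tfae_have 4 → 3 := by
      rintro ⟨V, hV, hne, hVX⟩ I _ _ _ F hF
      exact upperEntropy_eq_log_of_isOpen_subset hF hV hne hVX
    tfae_have 3 → 2 := by
      intro h
      have : IsDirectedOrder (ULift.{w} I₀) :=
        ⟨fun a b => (exists_ge_ge a.down b.down).imp' ULift.up fun _ => id⟩
      exact ⟨ULift.{w} I₀, inferInstance, this, inferInstance, _, hF₀.comp_down,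
        h _ _ this inferInstance _ hF₀.comp_down⟩
    tfae_have 2 → 1 := by
      rintro ⟨I, _, _, _, F, hF, hent⟩
      exact exists_preInjectiveOn hM hE' (preInjective_of_upperEntropy_eq_log hF hM hE' hent)
    tfae_have 2 → 4 := by
      rintro ⟨I, _, _, _, F, hF, hent⟩
      exact exists_isOpen_subset_range hM hE' (surjective_of_upperEntropy_eq_log hF hM hE' hent)
    tfae_finish
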